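/- Let $p$ be a prime and let $(\Omega,|\cdot|)$ be a field of characteristic $0$ with a non-archimedean absolute value normalised by $|p|=1/p$. For $\rho>0$ let $\mathcal A_\rho$ be the ring of power series $f=\sum_{s\ge 0}a_sT^s\in\Omega[[T]]$ with radius of convergence at least $\rho$, i.e. $|a_s|r^s\to 0$ for all $0<r<\rho$ (for a disk with centre $a$, $T=z-a$), and let $\mathcal A'_\rho=\mathrm{Frac}(\mathcal A_\rho)$, with the derivation $D=d/dT$. For $0<R<\rho$ put $|f|(R)=\sup_s|a_s|R^s$ for $f\in\mathcal A_\rho$ (if $\Omega$ is complete with infinite residue field and $R\in|\Omega^\times|$, this is $\sup_{|T|=R}|f(T)|$), extend it to $\mathcal A'_\rho$ by $|f/g|(R)=|f|(R)/|g|(R)$, and put $\|h\|_\rho=\limsup_{R\to\rho^-}|h|(R)\in[0,\infty]$; write $\|\cdot\|_0$ for $\|\cdot\|_1$. The norm of a matrix is the maximum of the norms of its entries. For integers $s,m\ge 0$ let $$\{s,m\}_p=\max\Big\{\frac1{|\lambda_1\cdots\lambda_k|_p}\;:\;0\le k\le m,\ 1\le\lambda_1<\dots<\lambda_k\le s\Big\},$$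 the empty product being $1$; if $m\le s$ it suffices to take $k=m$. 1. (Dwork–Robba) Let $u_1,\dots,u_n\in\mathcal A'_1$ have invertible Wronskian matrix $W=(D^iu_j)_{0\le i<n,\,1\le j\le n}$. For every $s\ge 0$ there is a unique row $(G_{s,0},\dots,G_{s,n-1})\in(\mathcal A'_1)^n$ with $\frac{D^s}{s!}(u_1,\dots,u_n)=(G_{s,0},\dots,G_{s,n-1})\,W$, and $\|G_{s,j}\|_0\le\{s,n-1\}_p$ for all $0\le j\le n-1$. 2. (Systems on the unit disk) Let $A\in M_n(\mathcal A'_1)$ and let $A_s$ be the matrices with $\frac{D^s}{s!}y=A_sy$ whenever $Dy=Ay$, that is $A_0=I$ and $(s+1)A_{s+1}=DA_s+A_sA$. If there is $Y\in GL_n(\mathcal A'_1)$ with $DY=AY$ (so that $D^sY/s!=A_sY$ for all $s$), then for all $s\ge 0$ $$\|A_s\|_0\le\{s,n-1\}_p\,\sup_{0\le i\le n-1}\|i!\,A_i\|_0.$$ 3. (Systems on a disk of radius $\rho$) Let $\rho>0$, let $A\in M_n(\mathcal A'_\rho)$, define $A_s$ as in 2, and suppose that there is $Y\in GL_n(\mathcal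 A'_\rho)$ with $DY=AY$. Then for all $s\ge 0$ $$\|A_s\|_\rho\le\rho^{-s}\,\{s,n-1\}_p\,\sup_{0\le i\le n-1}\rho^i\,\|i!\,A_i\|_\rho .$$ -/

import Mathlib

open Filter Topology PowerSeries
open scoped NNReal ENNReal

namespace DworkRobba
noncomputable section

/-! ### Extension of a derivation to the fraction field -/

section FractionDerivation
variable {R A K : Type*} [CommRing R] [CommRing A] [Field K] [Algebra R A] [Algebra A K]
  [IsFractionRing A K]

/-- `(d f * g - f * d g) / g ^ 2`, where `x = f / g`. -/
def quotientRule (d : Derivation R A A) (x : K) : K :=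
  (algebraMap A K (d (IsLocalization.sec (nonZeroDivisors A) x).1) *
      algebraMap A K (IsLocalization.sec (nonZeroDivisors A) x).2 -
    algebraMap A K (IsLocalization.sec (nonZeroDivisors A) x).1 *
      algebraMap A K (d (IsLocalization.sec (nonZeroDivisors A) x).2)) /
    algebraMap A K (IsLocalization.sec (nonZeroDivisors A) x).2 ^ 2

theorem sec_snd_ne_zero (x : K) :
    algebraMap A K (IsLocalization.sec (nonZeroDivisors A) x).2 ≠ 0 :=
  (IsLocalization.map_units K (IsLocalization.sec (nonZeroDivisors A) x).2).ne_zero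

theorem quotientRule_eq (d : Derivation R A A) {x : K} {f g : A}
    (hg : algebraMap A K g ≠ 0) (h : x * algebraMap A K g = algebraMap A K f) :
    quotientRule d x =
      (algebraMap A K (d f) * algebraMap A K g - algebraMap A K f * algebraMap A K (d g)) /
        algebraMap A K g ^ 2 := by
  unfold quotientRule
  have hs := IsLocalization.sec_spec (nonZeroDivisors A) x
  have hb := sec_snd_ne_zero (A := A) x
  revert hs hb
  generalize (IsLocalization.sec (nonZeroDivisors A) x).1 = a
  generalize ((IsLocalization.sec (nonZeroDivisors A) x).2 : A) = b
  intro hs hb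
  have h1 : a * g = f * b := by
    apply IsFractionRing.injective A K
    rw [map_mul, map_mul, ← hs, ← h]; ring
  have h2 : algebraMap A K (d a) * algebraMap A K g + algebraMap A K a * algebraMap A K (d g) =
      algebraMap A K (d f) * algebraMap A K b + algebraMap A K f * algebraMap A K (d b) := by
    have := congrArg (fun t => algebraMap A K (d t)) h1
    simp only [Derivation.leibniz, smul_eq_mul, map_add, map_mul] at this
    linear_combination this
  rw [div_eq_div_iff (pow_ne_zero 2 hb) (pow_ne_zero 2 hg)]
  rw [← hs, ← h] at h2 ⊢
  linear_combination (algebraMap A K g * algebraMap A K b) * h2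

theorem exists_fraction (x : K) :
    ∃ f g : A, algebraMap A K g ≠ 0 ∧ x * algebraMap A K g = algebraMap A K f :=
  ⟨_, _, sec_snd_ne_zero (A := A) x, IsLocalization.sec_spec _ x⟩

variable [Algebra R K] [IsScalarTower R A K]

/-- The unique extension of a derivation of `A` to a derivation of its fraction field `K`. -/
def fractionDerivation (d : Derivation R A A) : Derivation R K K :=
  Derivation.mk'
    { toFun := quotientRule d
      map_add' := fun x y => by
        obtain ⟨f, g, hg, h⟩ := exists_fraction (A := A) x
        obtain ⟨f', g', hg', h'⟩ := exists_fraction (A := A) y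
        rw [quotientRule_eq d hg h, quotientRule_eq d hg' h',
          quotientRule_eq d (f := f * g' + f' * g) (g := g * g') (by simp [hg, hg'])
            (by simp only [map_add, map_mul, ← h, ← h']; ring)]
        simp only [Derivation.leibniz, smul_eq_mul, map_add, map_mul]
        field_simp
        ring
      map_smul' := fun c x => by
        obtain ⟨f, g, hg, h⟩ := exists_fraction (A := A) x
        have hc (t : A) : algebraMap A K (c • t) = algebraMap R K c * algebraMap A K t := by
          rw [Algebra.smul_def, map_mul, ← IsScalarTower.algebraMap_apply]
        rw [quotientRule_eq d hg h, quotientRule_eq d (f := c • f) (g := g) hg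
          (by rw [Algebra.smul_mul_assoc, h, hc, Algebra.smul_def]), Derivation.map_smul, hc, hc,
          RingHom.id_apply, Algebra.smul_def]
        ring }
    (fun x y => by
        obtain ⟨f, g, hg, h⟩ := exists_fraction (A := A) x
        obtain ⟨f', g', hg', h'⟩ := exists_fraction (A := A) y
        change quotientRule d (x * y) = x • quotientRule d y + y • quotientRule d x
        rw [quotientRule_eq d hg h, quotientRule_eq d hg' h',
          quotientRule_eq d (f := f * f') (g := g * g') (by simp [hg, hg'])
            (by simp only [map_mul, ← h, ← h']; ring)]
        have e1 : x = algebraMap A K f / algebraMap A K g := by rw [← h]; field_simp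
        have e2 : y = algebraMap A K f' / algebraMap A K g' := by rw [← h']; field_simp
        rw [e1, e2]
        simp only [Derivation.leibniz, smul_eq_mul, map_add, map_mul]
        field_simp
        ring)

theorem fractionDerivation_algebraMap (d : Derivation R A A) (f : A) :
    (fractionDerivation d : Derivation R K K) (algebraMap A K f) = algebraMap A K (d f) := by
  change quotientRule d _ = _
  rw [quotientRule_eq d (f := f) (g := 1) (by simp) (by simp)]
  simp

end FractionDerivation

/-! ### Analytic functions on an open disk and their fractions -/

/-- The ring of power series `∑ a_s T ^ s` over `Ω` with radius of convergence at least `ρ`, that is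
`‖a_s‖ r ^ s → 0` for all `0 < r < ρ`.  For a disk with centre `a`, `T` is `z - a`. -/
def analyticRing (Ω : Type*) [NormedField Ω] [IsUltrametricDist Ω] (ρ : ℝ) :
    Subalgebra Ω Ω⟦X⟧ where
  carrier := {f | ∀ r : ℝ, 0 < r → r < ρ → IsRestricted r f}
  mul_mem' hf hg r h0 h1 := isRestricted.mul r (hf r h0 h1) (hg r h0 h1)
  add_mem' hf hg r h0 h1 := isRestricted.add r (hf r h0 h1) (hg r h0 h1)
  algebraMap_mem' c r _ _ := isRestricted_C r c

/-- The field of fractions of `analyticRing Ω ρ`. -/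
abbrev meroField (Ω : Type*) [NormedField Ω] [IsUltrametricDist Ω] (ρ : ℝ) : Type _ :=
  FractionRing (analyticRing Ω ρ)

section Analytic
variable {Ω : Type*} [NormedField Ω] [IsUltrametricDist Ω] {ρ : ℝ}

theorem derivative_mem {f : Ω⟦X⟧} (hf : f ∈ analyticRing Ω ρ) :
    PowerSeries.derivative Ω f ∈ analyticRing Ω ρ := by
  intro r h0 h1
  have h := (isRestricted_iff' r f).1 (hf r h0 h1)
  rw [isRestricted_iff']
  have h2 : Tendsto (fun s : ℕ => ‖coeff (s + 1) f‖ * r ^ (s + 1) * r⁻¹) atTop (𝓝 0) := by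
    simpa using (h.comp (tendsto_add_atTop_nat 1)).mul_const r⁻¹
  refine squeeze_zero (fun s => by positivity) (fun s => ?_) h2
  have h3 : ‖((s : Ω) + 1)‖ ≤ 1 := by
    simpa using IsUltrametricDist.norm_natCast_le_one Ω (s + 1)
  rw [coeff_derivative, norm_mul, pow_succ]
  have : ‖coeff (s + 1) f‖ * (r ^ s * r) * r⁻¹ = ‖coeff (s + 1) f‖ * r ^ s := by
    field_simp
  rw [this]
  gcongr
  exact mul_le_of_le_one_right (norm_nonneg _) h3

variable (Ω ρ) in
/-- `d/dT` on `analyticRing Ω ρ`. -/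
def analyticDerivation : Derivation Ω (analyticRing Ω ρ) (analyticRing Ω ρ) :=
  Derivation.mk'
    { toFun := fun f => ⟨PowerSeries.derivative Ω f, derivative_mem f.2⟩
      map_add' := fun f g => Subtype.ext (map_add (PowerSeries.derivative Ω) (f : Ω⟦X⟧) g)
      map_smul' := fun c f => Subtype.ext ((PowerSeries.derivative Ω).map_smul c (f : Ω⟦X⟧)) }
    (fun f g => Subtype.ext ((PowerSeries.derivative Ω).leibniz (f : Ω⟦X⟧) g))

variable (Ω ρ) in
/-- `D = d/dT` on `meroField Ω ρ`. -/
def D : Derivation Ω (meroField Ω ρ) (meroField Ω ρ) :=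
  fractionDerivation (analyticDerivation Ω ρ)

/-! ### Norms -/

/-- The norm `|f|_0(R) = sup_s ‖a_s‖ R ^ s` of a power series `f = ∑ a_s T ^ s`. -/
def radialNorm (R : ℝ) (f : Ω⟦X⟧) : ℝ := PowerSeries.gaussNorm (‖·‖) R f

/-- The extension `|f / g|_0(R) = |f|_0(R) / |g|_0(R)` of `radialNorm R` to `meroField Ω ρ`
(independent of the choice of `f` and `g` by `fracRadialNorm_eq`). -/
def fracRadialNorm (R : ℝ) (h : meroField Ω ρ) : ℝ :=
  radialNorm R ((IsLocalization.sec (nonZeroDivisors (analyticRing Ω ρ)) h).1 : Ω⟦X⟧) /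
    radialNorm R
      (((IsLocalization.sec (nonZeroDivisors (analyticRing Ω ρ)) h).2 : analyticRing Ω ρ) : Ω⟦X⟧)

/-- The norm `‖h‖ = limsup_{R → ρ⁻} |h|_0(R)`, with values in `[0, ∞]`. -/
def boundaryNorm (h : meroField Ω ρ) : ℝ≥0∞ :=
  limsup (fun R : ℝ => ENNReal.ofReal (fracRadialNorm R h)) (𝓝[<] ρ)

/-- The maximum of the norms of the entries of a matrix. -/
def matrixNorm {n : ℕ} (M : Matrix (Fin n) (Fin n) (meroField Ω ρ)) : ℝ≥0∞ :=
  ⨆ i, ⨆ j, boundaryNorm (M i j)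

/-! ### Wronskian matrices and differential systems -/

/-- The Wronskian matrix `(D ^ i u_j)`, `0 ≤ i, j < n`. -/
def wronskian {n : ℕ} (u : Fin n → meroField Ω ρ) : Matrix (Fin n) (Fin n) (meroField Ω ρ) :=
  Matrix.of fun i j => (D Ω ρ)^[(i : ℕ)] (u j)

/-- The matrices `A_s` such that `D ^ s y / s! = A_s y` whenever `D y = A y`:
`A_0 = 1` and `(s + 1) A_{s+1} = D A_s + A_s A`. -/
def iterMatrix {n : ℕ} (A : Matrix (Fin n) (Fin n) (meroField Ω ρ)) :
    ℕ → Matrix (Fin n) (Fin n) (meroField Ω ρ)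
  | 0 => 1
  | s + 1 => ((s + 1 : ℕ) : meroField Ω ρ)⁻¹ •
      ((iterMatrix A s).map (D Ω ρ) + iterMatrix A s * A)

end Analytic

/-- `{s, m}_p`: the maximum of `1 / |λ_1 ⋯ λ_k|_p` over the integers
`1 ≤ λ_1 < ⋯ < λ_k ≤ s` with `k ≤ m`. Since every factor `1 / |λ_i|_p` is at least `1`, only
`k = m` matters if `m ≤ s`. -/
def brace (p : ℕ) [Fact p.Prime] (s m : ℕ) : ℝ≥0 :=
  ((Finset.Icc 1 s).powerset.filter fun t => t.card ≤ m).sup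
    fun t => ∏ l ∈ t, ‖((l : ℕ) : ℚ_[p])‖₊⁻¹

/-! ### Consistency of the definitions -/

section Consistency
variable {Ω : Type*} [NormedField Ω]

/-- There is a least index at which the Gauss norm is attained. -/
theorem exists_dominant {R : ℝ} (hR : 0 < R) {f : Ω⟦X⟧} (hf : IsRestricted R f) (h0 : f ≠ 0) :
    ∃ i, (∀ k, ‖coeff k f‖ * R ^ k ≤ ‖coeff i f‖ * R ^ i) ∧
      (∀ k < i, ‖coeff k f‖ * R ^ k < ‖coeff i f‖ * R ^ i) ∧ 0 < ‖coeff i f‖ * R ^ i := by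
  obtain ⟨j, hj⟩ : ∃ j, coeff j f ≠ 0 := by
    by_contra! h; exact h0 (PowerSeries.ext (by simpa using h))
  have hpos : 0 < ‖coeff j f‖ * R ^ j := by positivity
  have hex : ∃ i, ∀ k, ‖coeff k f‖ * R ^ k ≤ ‖coeff i f‖ * R ^ i := by
    have ht := (isRestricted_iff' R f).1 hf
    obtain ⟨N, hN⟩ := eventually_atTop.1 (ht.eventually (gt_mem_nhds hpos))
    obtain ⟨i, -, hi⟩ := Finset.exists_max_image (Finset.range (max N (j + 1)))
      (fun k => ‖coeff k f‖ * R ^ k) ⟨j, by simp⟩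
    refine ⟨i, fun k => ?_⟩
    by_cases hk : k < max N (j + 1)
    · exact hi k (by simpa using hk)
    · exact (hN k (by omega)).le.trans (hi j (by simp))
  classical
  refine ⟨Nat.find hex, Nat.find_spec hex, fun k hk => ?_, hpos.trans_le (Nat.find_spec hex j)⟩
  have := Nat.find_min hex hk
  push Not at this
  obtain ⟨m, hm⟩ := this
  exact hm.trans_le (Nat.find_spec hex m)

theorem radialNorm_eq [IsUltrametricDist Ω] {R : ℝ} {f : Ω⟦X⟧} {i : ℕ}
    (h : ∀ k, ‖coeff k f‖ * R ^ k ≤ ‖coeff i f‖ * R ^ i) :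
    radialNorm R f = ‖coeff i f‖ * R ^ i := by
  rw [radialNorm, gaussNorm_eq]
  exact le_antisymm (ciSup_le h) (le_ciSup (f := fun k => ‖coeff k f‖ * R ^ k)
    ⟨_, Set.forall_mem_range.2 h⟩ i)

theorem radialNorm_zero [IsUltrametricDist Ω] (R : ℝ) : radialNorm R (0 : Ω⟦X⟧) = 0 :=
  gaussNorm_zero _ _ (by simp)

theorem radialNorm_pos [IsUltrametricDist Ω] {R : ℝ} (hR : 0 < R) {f : Ω⟦X⟧}
    (hf : IsRestricted R f) (h0 : f ≠ 0) : 0 < radialNorm R f := by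
  obtain ⟨i, hi, -, hip⟩ := exists_dominant hR hf h0
  rwa [radialNorm_eq hi]

theorem radialNorm_mul [IsUltrametricDist Ω] {R : ℝ} (hR : 0 < R) {f g : Ω⟦X⟧}
    (hf : IsRestricted R f) (hg : IsRestricted R g) :
    radialNorm R (f * g) = radialNorm R f * radialNorm R g := by
  rcases eq_or_ne f 0 with rfl | hf0
  · simp [radialNorm_zero]
  rcases eq_or_ne g 0 with rfl | hg0
  · simp [radialNorm_zero]
  obtain ⟨i, hi, hi', hip⟩ := exists_dominant hR hf hf0
  obtain ⟨j, hj, hj', hjp⟩ := exists_dominant hR hg hg0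
  rw [radialNorm_eq hi, radialNorm_eq hj]
  have hterm (a b : ℕ) : ‖coeff a f * coeff b g‖ * R ^ (a + b) =
      (‖coeff a f‖ * R ^ a) * (‖coeff b g‖ * R ^ b) := by rw [norm_mul, pow_add]; ring
  have h0 : 0 < ‖coeff i f * coeff j g‖ := by
    have : 0 < ‖coeff i f * coeff j g‖ * R ^ (i + j) := by rw [hterm]; positivity
    exact pos_of_mul_pos_left this (by positivity)
  have hmain : ‖coeff (i + j) (f * g)‖ = ‖coeff i f * coeff j g‖ := by
    have hij : (i, j) ∈ Finset.HasAntidiagonal.antidiagonal (i + j) :=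
      Finset.HasAntidiagonal.mem_antidiagonal.2 rfl
    rw [coeff_mul, ← Finset.add_sum_erase _ _ hij]
    have hlt : ‖∑ x ∈ (Finset.HasAntidiagonal.antidiagonal (i + j)).erase (i, j), coeff x.1 f * coeff x.2 g‖ <
        ‖coeff i f * coeff j g‖ := by
      rcases ((Finset.HasAntidiagonal.antidiagonal (i + j)).erase (i, j)).eq_empty_or_nonempty with h | h
      · rw [h]; simpa using h0
      obtain ⟨⟨a, b⟩, hx, hle⟩ := IsUltrametricDist.exists_norm_finsetSum_le_of_nonempty h
        (fun x : ℕ × ℕ => coeff x.1 f * coeff x.2 g)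
      refine hle.trans_lt ?_
      simp only [Finset.mem_erase, Finset.HasAntidiagonal.mem_antidiagonal, ne_eq, Prod.mk.injEq] at hx
      have hRp : 0 < R ^ (i + j) := by positivity
      refine lt_of_mul_lt_mul_right ?_ hRp.le
      rw [hterm, ← hx.2, hterm]
      rcases lt_or_ge a i with ha | ha
      · exact (mul_le_mul_of_nonneg_left (hj b) (by positivity)).trans_lt
          (mul_lt_mul_of_pos_right (hi' a ha) hjp)
      · have hb : b < j := by
          by_contra hb
          exact hx.1 ⟨by omega, by omega⟩
        exact mul_lt_mul' (hi a) (hj' b hb) (by positivity) hip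
    rw [IsUltrametricDist.norm_add_eq_max_of_norm_ne_norm hlt.ne', max_eq_left hlt.le]
  rw [radialNorm_eq (i := i + j), hmain, hterm]
  intro k
  rw [hmain, hterm, coeff_mul]
  have hRp : 0 < R ^ k := by positivity
  rw [← le_div_iff₀ hRp]
  refine IsUltrametricDist.norm_sum_le_of_forall_le_of_nonneg (by positivity) fun x hx => ?_
  rw [le_div_iff₀ hRp, ← Finset.HasAntidiagonal.mem_antidiagonal.1 hx, hterm]
  exact mul_le_mul (hi _) (hj _) (by positivity) hip.le

/-- The extension of `radialNorm R` to fractions does not depend on the chosen fraction. -/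
theorem fracRadialNorm_eq [IsUltrametricDist Ω] {ρ R : ℝ} (hR : 0 < R) (hRρ : R < ρ)
    {h : meroField Ω ρ} {f g : analyticRing Ω ρ} (hg : g ≠ 0)
    (e : h * algebraMap _ (meroField Ω ρ) g = algebraMap _ (meroField Ω ρ) f) :
    fracRadialNorm R h = radialNorm R (f : Ω⟦X⟧) / radialNorm R (g : Ω⟦X⟧) := by
  unfold fracRadialNorm
  have hs := IsLocalization.sec_spec (nonZeroDivisors (analyticRing Ω ρ)) h
  have hb := nonZeroDivisors.coe_ne_zero
    (IsLocalization.sec (nonZeroDivisors (analyticRing Ω ρ)) h).2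
  revert hs hb
  generalize (IsLocalization.sec (nonZeroDivisors (analyticRing Ω ρ)) h).1 = a
  generalize ((IsLocalization.sec (nonZeroDivisors (analyticRing Ω ρ)) h).2 :
    analyticRing Ω ρ) = b
  intro hs hb
  have h1 : a * g = f * b := by
    apply IsFractionRing.injective (analyticRing Ω ρ) (meroField Ω ρ)
    rw [map_mul, map_mul, ← hs, ← e]; ring
  have p (x : analyticRing Ω ρ) (hx : x ≠ 0) : 0 < radialNorm R (x : Ω⟦X⟧) :=
    radialNorm_pos hR (x.2 R hR hRρ) (by simpa using hx)
  rw [div_eq_div_iff (p b hb).ne' (p g hg).ne',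
    ← radialNorm_mul hR (a.2 R hR hRρ) (g.2 R hR hRρ),
    ← radialNorm_mul hR (f.2 R hR hRρ) (b.2 R hR hRρ)]
  exact congrArg (fun t : analyticRing Ω ρ => radialNorm R (t : Ω⟦X⟧)) h1

/-- If `Ω` is complete with dense value group, then `analyticRing Ω ρ` consists of the power series
that converge at all points of the open disk of radius `ρ` and centre `a`. -/
theorem mem_analyticRing_iff [IsUltrametricDist Ω] [CompleteSpace Ω]
    (hΩ : ∀ r t : ℝ, 0 < r → r < t → ∃ x : Ω, r < ‖x‖ ∧ ‖x‖ < t) (a : Ω) {ρ : ℝ} {f : Ω⟦X⟧} :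
    f ∈ analyticRing Ω ρ ↔ ∀ x : Ω, ‖x - a‖ < ρ → Summable fun s => coeff s f * (x - a) ^ s := by
  constructor
  · intro hf x hx
    rcases eq_or_ne (x - a) 0 with h | h
    · rw [h]
      refine summable_of_ne_finset_zero (s := {0}) fun s hs => ?_
      rw [zero_pow (by simpa using hs), mul_zero]
    · refine NonarchimedeanAddGroup.summable_of_tendsto_cofinite_zero ?_
      rw [tendsto_zero_iff_norm_tendsto_zero]
      simpa using (isRestricted_iff _ f).1 (hf ‖x - a‖ (norm_pos_iff.2 h) hx)
  · intro hf r h0 h1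
    obtain ⟨x, hx, hx'⟩ := hΩ r ρ h0 h1
    have := (hf (x + a) (by simpa using hx')).tendsto_cofinite_zero
    rw [tendsto_zero_iff_norm_tendsto_zero] at this
    rw [isRestricted_iff]
    refine squeeze_zero (fun s => by positivity) (fun s => ?_) this
    simp only [add_sub_cancel_right, norm_mul, norm_pow]
    gcongr

/-- If `Ω` is complete with infinite residue field, then the Gauss norm at `R = ‖y‖` is the maximum of
the absolute values taken on the sphere of radius `R`. -/
theorem radialNorm_isGreatest [IsUltrametricDist Ω] [CompleteSpace Ω]
    (hΩ : Infinite (IsLocalRing.ResidueField (NormedField.valuation (K := Ω)).valuationSubring))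
    {y : Ω} (hy : y ≠ 0) {f : Ω⟦X⟧} (hf : IsRestricted ‖y‖ f) :
    IsGreatest {v : ℝ | ∃ x : Ω, ‖x‖ = ‖y‖ ∧ v = ‖∑' s, coeff s f * x ^ s‖} (radialNorm ‖y‖ f) := by
  have hy' : 0 < ‖y‖ := norm_pos_iff.2 hy
  have hsum (x : Ω) (hx : ‖x‖ = ‖y‖) : Summable fun s => coeff s f * x ^ s := by
    refine NonarchimedeanAddGroup.summable_of_tendsto_cofinite_zero ?_
    rw [tendsto_zero_iff_norm_tendsto_zero]
    simpa [hx] using (isRestricted_iff _ f).1 hf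
  rcases eq_or_ne f 0 with rfl | hf0
  · rw [radialNorm_zero]
    exact ⟨⟨y, rfl, by simp⟩, by rintro v ⟨x, -, rfl⟩; simp⟩
  obtain ⟨i, hi, -, hip⟩ := exists_dominant hy' hf hf0
  rw [radialNorm_eq hi]
  refine ⟨?_, ?_⟩
  · set O := (NormedField.valuation (K := Ω)).valuationSubring with hO
    have hmem (x : Ω) : x ∈ O ↔ ‖x‖ ≤ 1 := by
      rw [hO, Valuation.mem_valuationSubring_iff, NormedField.valuation_apply]
      exact Iff.rfl
    have hunit (x : O) : IsLocalRing.residue O x ≠ 0 ↔ ‖(x : Ω)‖ = 1 := by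
      rw [IsLocalRing.residue_ne_zero_iff_isUnit]
      constructor
      · rintro ⟨u, rfl⟩
        have h1 := (hmem _).1 (u : O).2
        have h2 := (hmem _).1 ((u⁻¹ : Oˣ) : O).2
        have h3 : ‖((u : O) : Ω)‖ * ‖(((u⁻¹ : Oˣ) : O) : Ω)‖ = 1 := by
          rw [← norm_mul, ← MulMemClass.coe_mul, Units.mul_inv]; simp
        nlinarith [norm_nonneg ((u : O) : Ω), norm_nonneg (((u⁻¹ : Oˣ) : O) : Ω)]
      · intro h
        have h0 : (x : Ω) ≠ 0 := by intro h0; simp [h0] at h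
        exact IsUnit.of_mul_eq_one ⟨(x : Ω)⁻¹, (hmem _).2 (by simp [h])⟩
          (Subtype.ext (mul_inv_cancel₀ h0))
    set M := coeff i f * y ^ i with hM
    have hMn : 0 < ‖M‖ := by rw [hM]; simpa using hip
    set c : ℕ → Ω := fun s => coeff s f * y ^ s / M with hc
    have hc1 (s : ℕ) : ‖c s‖ ≤ 1 := by
      rw [hc]; simp only [norm_div]
      rw [div_le_one hMn, hM]; simpa using hi s
    have hci : c i = 1 := div_self (norm_pos_iff.1 hMn)
    have hct : Tendsto (fun s => ‖c s‖) atTop (𝓝 0) := by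
      simpa [hc, norm_div] using ((isRestricted_iff' _ f).1 hf).div_const ‖M‖
    obtain ⟨N, hN⟩ := eventually_atTop.1 (hct.eventually (gt_mem_nhds (by norm_num : (0:ℝ) < 1 / 2)))
    set N' := max N (i + 1)
    set P : Polynomial O := ∑ s ∈ Finset.range N', Polynomial.monomial s ⟨c s, (hmem _).2 (hc1 s)⟩
    have hP : P.coeff i = 1 := by
      simp only [P, Polynomial.finsetSum_coeff, Polynomial.coeff_monomial]
      rw [Finset.sum_ite_eq' (Finset.range N') i]
      rw [if_pos (by simp [N'])]
      exact Subtype.ext hci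
    have hPm : P.map (IsLocalRing.residue O) ≠ 0 := by
      intro h
      have := congrArg (fun q => Polynomial.coeff q i) h
      simp [hP] at this
    obtain ⟨t', ht'⟩ : ∃ t', (Polynomial.X * P.map (IsLocalRing.residue O)).eval t' ≠ 0 := by
      by_contra! h
      have h1 := Polynomial.eq_zero_of_infinite_isRoot
        (Polynomial.X * P.map (IsLocalRing.residue O)) (by
          rw [show {x | Polynomial.IsRoot _ x} = Set.univ from Set.eq_univ_of_forall h]
          exact Set.infinite_univ)
      exact (mul_ne_zero Polynomial.X_ne_zero hPm) h1
    obtain ⟨t, rfl⟩ := IsLocalRing.residue_surjective t'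
    rw [Polynomial.eval_mul, Polynomial.eval_X, Polynomial.eval_map_apply] at ht'
    have ht1 : ‖(t : Ω)‖ = 1 := (hunit t).1 (left_ne_zero_of_mul ht')
    have hPt := (hunit _).1 (right_ne_zero_of_mul ht')
    have hPt' : ((P.eval t : O) : Ω) = ∑ s ∈ Finset.range N', c s * (t : Ω) ^ s := by
      simp [P, Polynomial.eval_finsetSum]
    have hx : ‖y * t‖ = ‖y‖ := by rw [norm_mul, ht1, mul_one]
    refine ⟨y * t, hx, ?_⟩
    have hterm (s : ℕ) : coeff s f * (y * t) ^ s = M * (c s * (t : Ω) ^ s) := by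
      simp only [hc]; field_simp [norm_pos_iff.1 hMn]; ring
    have hs' : Summable fun s => c s * (t : Ω) ^ s := by
      have := hsum _ hx
      simp_rw [hterm] at this
      exact (summable_mul_left_iff (norm_pos_iff.1 hMn)).1 this
    simp_rw [hterm]
    rw [tsum_mul_left, ← hs'.sum_add_tsum_nat_add N', ← hPt']
    have htail : ‖∑' s, c (s + N') * (t : Ω) ^ (s + N')‖ ≤ 1 / 2 := by
      refine le_of_tendsto ((summable_nat_add_iff N').2 hs').hasSum.norm
        (Eventually.of_forall fun T => ?_)
      refine IsUltrametricDist.norm_sum_le_of_forall_le_of_nonneg (by positivity) fun s _ => ?_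
      rw [norm_mul, norm_pow, ht1, one_pow, mul_one]
      exact (hN _ (by omega)).le
    rw [norm_mul, IsUltrametricDist.norm_add_eq_max_of_norm_ne_norm (by rw [hPt]; linarith), hPt,
      max_eq_left (by linarith), mul_one, hM, norm_mul, norm_pow]
  · rintro v ⟨x, hx, rfl⟩
    refine le_of_tendsto (hsum x hx).hasSum.norm (Eventually.of_forall fun t => ?_)
    refine IsUltrametricDist.norm_sum_le_of_forall_le_of_nonneg (by positivity) fun s _ => ?_
    simpa [hx] using hi s

/-- The matrices `iterMatrix A s` have their defining property. -/
theorem iterMatrix_spec [IsUltrametricDist Ω] [CharZero Ω] {ρ : ℝ} {n : ℕ}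
    {A : Matrix (Fin n) (Fin n) (meroField Ω ρ)} {y : Fin n → meroField Ω ρ}
    (hy : ∀ i, D Ω ρ (y i) = A.mulVec y i) (s : ℕ) (i : Fin n) :
    ((s.factorial : ℕ) : meroField Ω ρ)⁻¹ * (D Ω ρ)^[s] (y i) = (iterMatrix A s).mulVec y i := by
  have : CharZero (meroField Ω ρ) := charZero_of_injective_algebraMap (algebraMap Ω (meroField Ω ρ)).injective
  rw [inv_mul_eq_iff_eq_mul₀ (by exact_mod_cast s.factorial_ne_zero)]
  induction s generalizing i with
  | zero => simp [iterMatrix]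
  | succ s ih =>
    have hs : ((s + 1 : ℕ) : meroField Ω ρ) ≠ 0 := by exact_mod_cast s.succ_ne_zero
    have key : D Ω ρ ((iterMatrix A s).mulVec y i) =
        (((iterMatrix A s).map (D Ω ρ) + iterMatrix A s * A).mulVec y) i := by
      rw [Matrix.add_mulVec, ← Matrix.mulVec_mulVec, Pi.add_apply]
      simp only [Matrix.mulVec, dotProduct, map_sum, Derivation.leibniz, smul_eq_mul,
        Finset.sum_add_distrib, Matrix.map_apply, hy]
      rw [add_comm]
      congr 1
      exact Finset.sum_congr rfl fun j _ => mul_comm _ _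
    rw [Function.iterate_succ_apply', ih, Derivation.leibniz, Derivation.map_natCast, key,
      iterMatrix, Matrix.smul_mulVec, Pi.smul_apply, smul_eq_mul, smul_eq_mul, smul_eq_mul,
      mul_zero, add_zero, Nat.factorial_succ, Nat.cast_mul]
    field_simp

end Consistency

end
end DworkRobba

/-! Let `|·|` be the Gauss norm of radius `R < ρ` on the field of fractions. It is multiplicative,
so the Cauchy estimates `|D ^ s h / s!| ≤ R ^ (-s) |h|` pass from power series to their quotients.

Induct on the number of functions. Divide the family by a nonzero member `w` and differentiate:
this kills one function, so the induction hypothesis expresses `D ^ s / s!` on the derivatives by an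
operator of lower order. As `D ^ (s + 1) / (s + 1)! = (s + 1)⁻¹ (D ^ s / s!) D`, integrating back
costs the factor `1 / |s + 1|`, which is how `{s, n - 1}_p` acquires one more factor at each step.
By the Cauchy estimates, conjugation by `w` does not enlarge the norm of an operator. Applied to the
rows of a solution matrix, this expresses `A_s` through the `i! A_i` with `i < n`. Finally let
`R → ρ`. -/

namespace DworkRobba
noncomputable section

section DividedIterates
variable {R K : Type*} [CommRing R] [Field K] [Algebra R K]

theorem iterate_derivation_mul {A : Type*} [CommRing A] [Algebra R A] (d : Derivation R A A)
    (s : ℕ) (x y : A) :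
    d^[s] (x * y) = ∑ ij ∈ Finset.HasAntidiagonal.antidiagonal s,
      (s.choose ij.1 : A) * (d^[ij.1] x * d^[ij.2] y) := by
  induction s with
  | zero => simp
  | succ s ih =>
    rw [Finset.sum_antidiagonal_choose_succ_mul (fun i j => d^[i] x * d^[j] y),
      Function.iterate_succ_apply', ih, map_sum, ← Finset.sum_add_distrib]
    refine Finset.sum_congr rfl fun ij hij => ?_
    have hs : s.choose ij.2 = s.choose ij.1 := by
      rw [← Finset.HasAntidiagonal.mem_antidiagonal.1 hij, Nat.choose_symm_add]
    simp only [Derivation.leibniz, Derivation.map_natCast, smul_eq_mul,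
      Function.iterate_succ_apply', hs]
    ring

/-- The divided iterate `d ^ s / s!` of a derivation `d` of a field (of characteristic `0`, as the
junk value `0⁻¹ = 0` enters otherwise), that is the `s`-th Taylor coefficient. -/
def dividedIterate (d : Derivation R K K) (s : ℕ) (x : K) : K :=
  ((s.factorial : ℕ) : K)⁻¹ * d^[s] x

theorem dividedIterate_zero (d : Derivation R K K) (x : K) : dividedIterate d 0 x = x := by
  simp [dividedIterate]

theorem dividedIterate_apply_zero (d : Derivation R K K) (s : ℕ) : dividedIterate d s 0 = 0 := by
  simp [dividedIterate]

theorem dividedIterate_succ (d : Derivation R K K) (s : ℕ) (x : K) :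
    dividedIterate d (s + 1) x = ((s + 1 : ℕ) : K)⁻¹ * dividedIterate d s (d x) := by
  simp only [dividedIterate, Function.iterate_succ_apply, Nat.factorial_succ, Nat.cast_mul, mul_inv]
  ring

variable [CharZero K]

theorem factorial_mul_dividedIterate (d : Derivation R K K) (s : ℕ) (x : K) :
    ((s.factorial : ℕ) : K) * dividedIterate d s x = d^[s] x :=
  mul_inv_cancel_left₀ (by exact_mod_cast s.factorial_ne_zero) _

theorem dividedIterate_mul (d : Derivation R K K) (s : ℕ) (x y : K) :
    dividedIterate d s (x * y) = ∑ ij ∈ Finset.HasAntidiagonal.antidiagonal s,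
      dividedIterate d ij.1 x * dividedIterate d ij.2 y := by
  rw [dividedIterate, iterate_derivation_mul, Finset.mul_sum]
  refine Finset.sum_congr rfl fun ij hij => ?_
  have hchoose : (s.choose ij.1 : K) * ij.1.factorial * ij.2.factorial = s.factorial := by
    rw [← Finset.HasAntidiagonal.mem_antidiagonal.1 hij]
    exact_mod_cast Nat.choose_symm_add ▸ Nat.add_choose_mul_factorial_mul_factorial ij.1 ij.2
  rw [inv_mul_eq_iff_eq_mul₀ (by exact_mod_cast s.factorial_ne_zero), ← hchoose,
    ← factorial_mul_dividedIterate, ← factorial_mul_dividedIterate]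
  ring

end DividedIterates

section TaylorBounds
variable {R K : Type*} [CommRing R] [Field K] [Algebra R K] {d : Derivation R K K}
  {v : AbsoluteValue K ℝ} {r : ℝ}

theorem apply_sum_le_of_forall_le {α : Type*} (hv : IsNonarchimedean v) {t : Finset α} {f : α → K}
    {C : ℝ} (hC : 0 ≤ C) (h : ∀ a ∈ t, v (f a) ≤ C) : v (∑ a ∈ t, f a) ≤ C :=
  hv.apply_sum_le.trans (Real.iSup_le (fun a => h a a.2) hC)

/-- The Cauchy estimates of radius `r` for the Taylor coefficients of `x`, relative to `v x`. -/
def TaylorBoundedAt (d : Derivation R K K) (v : AbsoluteValue K ℝ) (r : ℝ) (x : K) : Prop :=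
  ∀ s, v (dividedIterate d s x) ≤ (r ^ s)⁻¹ * v x

variable [CharZero K]

theorem TaylorBoundedAt.apply_iterate_le {x : K} (hx : TaylorBoundedAt d v r x)
    (hv : IsNonarchimedean v) (s : ℕ) : v (d^[s] x) ≤ (r ^ s)⁻¹ * v x := by
  rw [← factorial_mul_dividedIterate, map_mul]
  exact (mul_le_of_le_one_left (v.nonneg _) hv.apply_natCast_le_one).trans (hx s)

theorem TaylorBoundedAt.of_mul_right (hv : IsNonarchimedean v) (hr : 0 < r) {h g : K} (hg : g ≠ 0)
    (hdg : TaylorBoundedAt d v r g) (hdf : TaylorBoundedAt d v r (h * g)) :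
    TaylorBoundedAt d v r h := by
  intro s
  have := v.nonneg h
  induction s using Nat.strong_induction_on with
  | _ s ih =>
    have hsum : dividedIterate d s h * g = dividedIterate d s (h * g) -
        ∑ i ∈ Finset.range s, dividedIterate d i h * dividedIterate d (s - i) g := by
      rw [dividedIterate_mul, Finset.Nat.sum_antidiagonal_eq_sum_range_succ
        (fun i j => dividedIterate d i h * dividedIterate d j g), Finset.sum_range_succ,
        Nat.sub_self, dividedIterate_zero, add_sub_cancel_left]
    refine le_of_mul_le_mul_right ?_ (v.pos hg)
    rw [← map_mul, hsum, sub_eq_add_neg, mul_assoc, ← map_mul]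
    refine (hv _ _).trans (max_le (hdf s) ?_)
    rw [AbsoluteValue.map_neg]
    refine apply_sum_le_of_forall_le hv (by positivity) fun i hi => ?_
    rw [Finset.mem_range] at hi
    calc v (dividedIterate d i h * dividedIterate d (s - i) g)
        = v (dividedIterate d i h) * v (dividedIterate d (s - i) g) := map_mul _ _ _
      _ ≤ (r ^ i)⁻¹ * v h * ((r ^ (s - i))⁻¹ * v g) := by
          gcongr
          exacts [ih i hi, hdg _]
      _ = (r ^ s)⁻¹ * v (h * g) := by
          rw [map_mul, pow_sub₀ _ hr.ne' hi.le]
          field_simp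

end TaylorBounds

section DifferentialOperators
variable {R K : Type*} [CommRing R] [Field K] [Algebra R K] {d : Derivation R K K}
  {v : AbsoluteValue K ℝ} {r : ℝ} {n : ℕ} {C : ℝ} {P : K → K}

/-- `P` is a differential operator `∑ j, G j * d ^ j` of order less than `n` whose norm
`max |G j| / r ^ j` is at most `C`. With this normalisation, operators on functions that satisfy
the Cauchy estimates of radius `r` have submultiplicative norms. -/
def IsDiffOpWithBound (d : Derivation R K K) (v : AbsoluteValue K ℝ) (r : ℝ) (n : ℕ) (C : ℝ)
    (P : K → K) : Prop :=
  ∃ G : Fin n → K, (∀ x, P x = ∑ j, G j * d^[(j : ℕ)] x) ∧ ∀ j, v (G j) ≤ C * r ^ (j : ℕ)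

namespace IsDiffOpWithBound

theorem map_zero (hP : IsDiffOpWithBound d v r n C P) : P 0 = 0 := by
  obtain ⟨G, hG, -⟩ := hP
  simp [hG]

theorem mono (hP : IsDiffOpWithBound d v r n C P) (hr : 0 ≤ r) {C' : ℝ} (hC : C ≤ C') :
    IsDiffOpWithBound d v r n C' P := by
  obtain ⟨G, hG, hb⟩ := hP
  exact ⟨G, hG, fun j => (hb j).trans (by gcongr)⟩

theorem zero (hr : 0 ≤ r) (hC : 0 ≤ C) : IsDiffOpWithBound d v r n C fun _ => 0 :=
  ⟨0, by simp, fun j => by simpa using by positivity⟩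

theorem monomial (hr : 0 ≤ r) (hC : 0 ≤ C) {k : ℕ} (hk : k < n) {g : K} (hg : v g ≤ C * r ^ k) :
    IsDiffOpWithBound d v r n C fun x => g * d^[k] x := by
  classical
  refine ⟨Pi.single ⟨k, hk⟩ g, fun x => ?_, fun j => ?_⟩
  · rw [Fintype.sum_eq_single ⟨k, hk⟩ fun j hj => by simp [hj], Pi.single_eq_same]
  · rcases eq_or_ne j ⟨k, hk⟩ with rfl | hj
    · simpa using hg
    · simpa [hj] using by positivity

theorem sum {α : Type*} {t : Finset α} {Q : α → K → K} (hv : IsNonarchimedean v) (hr : 0 ≤ r)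
    (hC : 0 ≤ C) (hQ : ∀ a ∈ t, IsDiffOpWithBound d v r n C (Q a)) :
    IsDiffOpWithBound d v r n C fun x => ∑ a ∈ t, Q a x := by
  choose! G hG hb using hQ
  refine ⟨fun j => ∑ a ∈ t, G a j, fun x => ?_, fun j =>
    apply_sum_le_of_forall_le hv (by positivity) fun a ha => hb a ha j⟩
  simp_rw [Finset.sum_mul]
  rw [Finset.sum_comm]
  exact Finset.sum_congr rfl fun a ha => hG a ha x

theorem const_mul (hP : IsDiffOpWithBound d v r n C P) {g : K} :
    IsDiffOpWithBound d v r n (v g * C) fun x => g * P x := by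
  obtain ⟨G, hG, hb⟩ := hP
  refine ⟨fun j => g * G j, fun x => ?_, fun j => ?_⟩
  · simp only [hG, Finset.mul_sum, mul_assoc]
  · rw [map_mul, mul_assoc]
    exact mul_le_mul_of_nonneg_left (hb j) (v.nonneg g)

theorem comp_derivation (hP : IsDiffOpWithBound d v r n C P) (hr : 0 < r) (hC : 0 ≤ C) :
    IsDiffOpWithBound d v r (n + 1) (C / r) fun x => P (d x) := by
  obtain ⟨G, hG, hb⟩ := hP
  refine ⟨Fin.cons 0 G, fun x => ?_, Fin.cases ?_ fun j => ?_⟩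
  · simp [hG, Fin.sum_univ_succ]
  · simpa using by positivity
  · simpa [pow_succ', div_mul_eq_mul_div, mul_div_assoc, hr.ne'] using hb j

theorem comp_mul_left [CharZero K] (hP : IsDiffOpWithBound d v r n C P) (hv : IsNonarchimedean v)
    (hr : 0 < r) (hC : 0 ≤ C) {w : K} (hw : TaylorBoundedAt d v r w) :
    IsDiffOpWithBound d v r n (C * v w) fun x => P (w * x) := by
  obtain ⟨G, hG, hb⟩ := hP
  have hCw : 0 ≤ C * v w := mul_nonneg hC (v.nonneg w)
  simp_rw [hG, iterate_derivation_mul, Finset.mul_sum, ← mul_assoc]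
  refine sum hv hr.le hCw fun k _ => sum hv hr.le hCw fun ij hij => ?_
  rw [Finset.HasAntidiagonal.mem_antidiagonal] at hij
  refine monomial hr.le hCw (by omega) ?_
  calc v (G k * ((k : ℕ).choose ij.1 : K) * d^[ij.1] w)
      ≤ C * r ^ (k : ℕ) * 1 * ((r ^ ij.1)⁻¹ * v w) := by
        rw [map_mul, map_mul]
        gcongr
        exacts [hb k, hv.apply_natCast_le_one, hw.apply_iterate_le hv _]
    _ = C * v w * r ^ ij.2 := by
        rw [← hij, pow_add]
        field_simp

end IsDiffOpWithBound

end DifferentialOperators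

section Reduction
variable {R K : Type*} [CommRing R] [Field K] [Algebra R K] {d : Derivation R K K}
  {v : AbsoluteValue K ℝ} {r : ℝ} {n : ℕ} {B : ℕ → ℝ} {ι : Type*} {u : ι → K}

/-- On the family `u`, every divided iterate `d ^ s / s!` agrees with a differential operator of
order less than `n` and norm at most `B s / r ^ s`. -/
def TaylorReducible (d : Derivation R K K) (v : AbsoluteValue K ℝ) (r : ℝ) (n : ℕ) (B : ℕ → ℝ)
    (u : ι → K) : Prop :=
  ∀ s, ∃ P, IsDiffOpWithBound d v r n ((r ^ s)⁻¹ * B s) P ∧ ∀ c, dividedIterate d s (u c) = P (u c)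

namespace TaylorReducible

theorem of_forall_eq_zero (hr : 0 ≤ r) (hB : 0 ≤ B) (hu : ∀ c, u c = 0) :
    TaylorReducible d v r n B u := fun s =>
  ⟨fun _ => 0, .zero hr (mul_nonneg (by positivity) (hB s)),
    fun c => by rw [hu, dividedIterate_apply_zero]⟩

theorem of_derivation (hr : 0 < r) (hB : 0 ≤ B)
    (hu : TaylorReducible d v r n B fun c => d (u c)) {B' : ℕ → ℝ} (hB' : 1 ≤ B' 0)
    (hBB' : ∀ s, (v ((s + 1 : ℕ) : K))⁻¹ * B s ≤ B' (s + 1)) :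
    TaylorReducible d v r (n + 1) B' u
  | 0 => ⟨fun x => 1 * d^[0] x, .monomial hr.le (by simpa using zero_le_one.trans hB')
      n.succ_pos (by simpa using hB'), fun c => by simp [dividedIterate_zero]⟩
  | s + 1 => by
    obtain ⟨P, hP, hPu⟩ := hu s
    have hBs : 0 ≤ (r ^ s)⁻¹ * B s := mul_nonneg (by positivity) (hB s)
    refine ⟨fun x => ((s + 1 : ℕ) : K)⁻¹ * P (d x),
      (hP.comp_derivation hr hBs).const_mul.mono hr.le ?_,
      fun c => by rw [dividedIterate_succ, hPu]⟩
    calc v ((s + 1 : ℕ) : K)⁻¹ * ((r ^ s)⁻¹ * B s / r)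
        = (r ^ (s + 1))⁻¹ * ((v ((s + 1 : ℕ) : K))⁻¹ * B s) := by
          rw [map_inv₀, pow_succ]
          field_simp
      _ ≤ (r ^ (s + 1))⁻¹ * B' (s + 1) := by
          gcongr
          exact hBB' s

variable [CharZero K]

theorem mul (hv : IsNonarchimedean v) (hr : 0 < r) (hd : ∀ x, TaylorBoundedAt d v r x)
    (hB : 0 ≤ B) (hmono : Monotone B) (hu : TaylorReducible d v r n B u) {w : K} (hw : w ≠ 0) :
    TaylorReducible d v r n B fun c => w * u c := by
  intro s
  choose P hP hPu using hu
  have hBs : 0 ≤ (r ^ s)⁻¹ * B s := mul_nonneg (by positivity) (hB s)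
  refine ⟨fun x => ∑ ij ∈ Finset.HasAntidiagonal.antidiagonal s,
      dividedIterate d ij.1 w * P ij.2 (w⁻¹ * x), .sum hv hr.le hBs fun ij hij => ?_, fun c => ?_⟩
  · have hBj := hB ij.2
    refine ((hP ij.2).comp_mul_left hv hr (mul_nonneg (by positivity) hBj)
      (hd w⁻¹)).const_mul.mono hr.le ?_
    rw [Finset.HasAntidiagonal.mem_antidiagonal] at hij
    have hvw := v.ne_zero hw
    calc v (dividedIterate d ij.1 w) * ((r ^ ij.2)⁻¹ * B ij.2 * v w⁻¹)
        ≤ (r ^ ij.1)⁻¹ * v w * ((r ^ ij.2)⁻¹ * B ij.2 * v w⁻¹) := by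
          have : 0 ≤ B ij.2 := hBj
          gcongr
          exact hd w _
      _ = (r ^ s)⁻¹ * B ij.2 := by
          rw [map_inv₀, ← hij, pow_add]
          field_simp
      _ ≤ (r ^ s)⁻¹ * B s := by
          gcongr
          exact hmono (by omega)
  · simp only [dividedIterate_mul, hPu, inv_mul_cancel_left₀ hw]

theorem of_derivation_inv_mul (hv : IsNonarchimedean v) (hr : 0 < r)
    (hd : ∀ x, TaylorBoundedAt d v r x) (hB : 0 ≤ B) {w : K} (hw : w ≠ 0)
    (hu : TaylorReducible d v r n B fun c => d (w⁻¹ * u c)) {B' : ℕ → ℝ} (hB' : 1 ≤ B' 0)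
    (hmono : Monotone B') (hBB' : ∀ s, (v ((s + 1 : ℕ) : K))⁻¹ * B s ≤ B' (s + 1)) :
    TaylorReducible d v r (n + 1) B' u := by
  have hB'0 : 0 ≤ B' := fun s => zero_le_one.trans (hB'.trans (hmono s.zero_le))
  simpa [mul_inv_cancel_left₀ hw] using
    (hu.of_derivation hr hB hB' hBB').mul hv hr hd hB'0 hmono hw

end TaylorReducible

end Reduction

section Brace
variable (p : ℕ) [Fact p.Prime]

theorem one_le_brace (s m : ℕ) : 1 ≤ brace p s m := by
  have h : (∅ : Finset ℕ) ∈ (Finset.Icc 1 s).powerset.filter fun t => t.card ≤ m := by simp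
  exact Finset.prod_empty.symm.le.trans
    (Finset.le_sup (f := fun t : Finset ℕ => ∏ l ∈ t, ‖((l : ℕ) : ℚ_[p])‖₊⁻¹) h)

theorem monotone_brace (m : ℕ) : Monotone fun s => brace p s m := fun _ _ h =>
  Finset.sup_mono <| Finset.filter_subset_filter _ <|
    Finset.powerset_mono.2 (Finset.Icc_subset_Icc_right h)

theorem inv_nnnorm_mul_brace_le (s m : ℕ) :
    ‖((s + 1 : ℕ) : ℚ_[p])‖₊⁻¹ * brace p s m ≤ brace p (s + 1) (m + 1) := by
  conv_lhs => rw [brace]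
  rw [NNReal.mul_finset_sup]
  refine Finset.sup_le fun t ht => ?_
  rw [Finset.mem_filter, Finset.mem_powerset] at ht
  have hs : s + 1 ∉ t := fun h => by simpa using ht.1 h
  rw [← Finset.prod_insert (f := fun l : ℕ => ‖((l : ℕ) : ℚ_[p])‖₊⁻¹) hs]
  refine Finset.le_sup (f := fun t : Finset ℕ => ∏ l ∈ t, ‖((l : ℕ) : ℚ_[p])‖₊⁻¹) ?_
  rw [Finset.mem_filter, Finset.mem_powerset, Finset.card_insert_of_notMem hs]
  exact ⟨Finset.insert_subset (by simp) (ht.1.trans (Finset.Icc_subset_Icc_right (by omega))),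
    by omega⟩

variable {p} {K : Type*} [Field K] {v : AbsoluteValue K ℝ}

theorem apply_natCast_eq_one_of_not_dvd (hv : IsNonarchimedean v) (hp : v p < 1) {q : ℕ}
    (hq : ¬p ∣ q) : v q = 1 := by
  refine le_antisymm hv.apply_natCast_le_one (le_of_not_gt fun hlt => ?_)
  obtain ⟨a, b, hab⟩ : IsCoprime (q : ℤ) p :=
    Nat.isCoprime_iff_coprime.2 ((Fact.out : p.Prime).coprime_iff_not_dvd.2 hq).symm
  have hab' : (a : K) * q + b * p = 1 := by exact_mod_cast congrArg (Int.cast : ℤ → K) hab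
  have h1 := hv ((a : K) * q) (b * p)
  rw [hab', map_one, map_mul, map_mul] at h1
  exact absurd h1 (not_le.2 (max_lt
    ((mul_le_of_le_one_left (v.nonneg _) hv.apply_intCast_le_one).trans_lt hlt)
    ((mul_le_of_le_one_left (v.nonneg _) hv.apply_intCast_le_one).trans_lt hp)))

theorem apply_natCast_eq_norm_padic (hv : IsNonarchimedean v) (hp : v p = (p : ℝ)⁻¹) {m : ℕ}
    (hm : m ≠ 0) : v m = ‖(m : ℚ_[p])‖ := by
  have hp1 : v p < 1 := by
    rw [hp]
    exact inv_lt_one_of_one_lt₀ (by exact_mod_cast (Fact.out : p.Prime).one_lt)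
  obtain ⟨k, q, hq, rfl⟩ :=
    Nat.exists_eq_pow_mul_and_not_dvd hm p (Fact.out : p.Prime).one_lt.ne'
  have hq' : ‖(q : ℚ_[p])‖ = 1 :=
    Padic.norm_natCast_eq_one_iff.2 ((Fact.out : p.Prime).coprime_iff_not_dvd.2 hq)
  simp only [Nat.cast_mul, Nat.cast_pow, norm_mul, norm_pow, map_mul, map_pow, hp, Padic.norm_p,
    apply_natCast_eq_one_of_not_dvd hv hp1 hq, hq']

end Brace

section DworkRobbaTheorem
variable {p : ℕ} [Fact p.Prime] {R K : Type*} [CommRing R] [Field K] [Algebra R K] [CharZero K]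
  {d : Derivation R K K} {v : AbsoluteValue K ℝ} {r : ℝ}

theorem taylorReducible_brace_succ (hv : IsNonarchimedean v) (hp : v p = (p : ℝ)⁻¹) (hr : 0 < r)
    (hd : ∀ x, TaylorBoundedAt d v r x) {n : ℕ} (u : Fin (n + 1) → K) :
    TaylorReducible d v r (n + 1) (fun s => brace p s n) u := by
  have hB0 (m : ℕ) : (0 : ℕ → ℝ) ≤ fun s => (brace p s m : ℝ) := fun s => NNReal.coe_nonneg _
  have hB1 (m : ℕ) : (1 : ℝ) ≤ brace p 0 m := by exact_mod_cast one_le_brace p 0 m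
  have hmono (m : ℕ) : Monotone fun s => (brace p s m : ℝ) := fun _ _ h => by
    exact_mod_cast monotone_brace p m h
  by_cases hu : ∀ c, u c = 0
  · exact .of_forall_eq_zero hr.le (hB0 n) hu
  push Not at hu
  obtain ⟨c₀, hc₀⟩ := hu
  have hc₀' : d ((u c₀)⁻¹ * u c₀) = 0 := by rw [inv_mul_cancel₀ hc₀, Derivation.map_one_eq_zero]
  match n with
  | 0 =>
    refine .of_derivation_inv_mul (B := 0) hv hr hd le_rfl hc₀
      (.of_forall_eq_zero hr.le le_rfl fun c => ?_) (hB1 0) (hmono 0) fun s => by simp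
    rw [Fin.fin_one_eq_zero c, ← Fin.fin_one_eq_zero c₀, hc₀']
  | m + 1 =>
    refine .of_derivation_inv_mul hv hr hd (hB0 m) hc₀ (fun s => ?_) (hB1 (m + 1))
      (hmono (m + 1)) fun s => ?_
    · obtain ⟨P, hP, hPu⟩ := taylorReducible_brace_succ hv hp hr hd
        (fun c : Fin (m + 1) => d ((u c₀)⁻¹ * u (c₀.succAbove c))) s
      refine ⟨P, hP, (Fin.forall_iff_succAbove c₀).2 ⟨?_, hPu⟩⟩
      simp only [hc₀', dividedIterate_apply_zero, hP.map_zero]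
    · rw [apply_natCast_eq_norm_padic hv hp s.succ_ne_zero]
      exact_mod_cast inv_nnnorm_mul_brace_le p s m

theorem taylorReducible_brace (hv : IsNonarchimedean v) (hp : v p = (p : ℝ)⁻¹) (hr : 0 < r)
    (hd : ∀ x, TaylorBoundedAt d v r x) {n : ℕ} (u : Fin n → K) :
    TaylorReducible d v r n (fun s => brace p s (n - 1)) u := by
  cases n with
  | zero => exact .of_forall_eq_zero hr.le (fun s => NNReal.coe_nonneg _) fun c => c.elim0
  | succ n => exact taylorReducible_brace_succ hv hp hr hd u

end DworkRobbaTheorem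

section GaussNorm
variable {Ω : Type*} [NormedField Ω] [IsUltrametricDist Ω] {ρ R : ℝ}

theorem hasGaussNorm_of_isRestricted {Ω : Type*} [NormedField Ω] {R : ℝ} {f : Ω⟦X⟧}
    (hf : IsRestricted R f) : HasGaussNorm (‖·‖) R f :=
  ((isRestricted_iff' R f).1 hf).bddAbove_range

theorem radialNorm_nonneg {Ω : Type*} [NormedField Ω] {R : ℝ} (f : Ω⟦X⟧) : 0 ≤ radialNorm R f :=
  gaussNorm_nonneg _ _ _ norm_nonneg

theorem radialNorm_C (c : Ω) : radialNorm R (C c : Ω⟦X⟧) = ‖c‖ := by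
  rw [radialNorm_eq (i := 0) fun k => ?_]
  · simp
  · rcases eq_or_ne k 0 with rfl | hk
    · rfl
    · simp [coeff_C, hk]

theorem radialNorm_iterate_derivative_le (hR : 0 < R) {f : Ω⟦X⟧} (hf : IsRestricted R f) (s : ℕ) :
    radialNorm R ((PowerSeries.derivative Ω)^[s] f) ≤
      ‖(s.factorial : Ω)‖ * ((R ^ s)⁻¹ * radialNorm R f) := by
  refine (gaussNorm_eq _ _ _).trans_le (ciSup_le fun k => ?_)
  rw [coeff_iterate_derivative, Nat.ascFactorial_eq_factorial_mul_choose, norm_mul, Nat.cast_mul,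
    norm_mul]
  calc ‖(s.factorial : Ω)‖ * ‖((k + s).choose s : Ω)‖ * ‖coeff (k + s) f‖ * R ^ k
      ≤ ‖(s.factorial : Ω)‖ * 1 * ‖coeff (k + s) f‖ * R ^ k := by
        gcongr
        exact IsUltrametricDist.norm_natCast_le_one Ω _
    _ = ‖(s.factorial : Ω)‖ * ((R ^ s)⁻¹ * (‖coeff (k + s) f‖ * R ^ (k + s))) := by
        rw [pow_add]
        field_simp
    _ ≤ ‖(s.factorial : Ω)‖ * ((R ^ s)⁻¹ * radialNorm R f) := by
        gcongr
        exact le_gaussNorm (‖·‖) R f (hasGaussNorm_of_isRestricted hf) (k + s)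

theorem algebraMap_ne_zero {g : analyticRing Ω ρ} (hg : g ≠ 0) :
    algebraMap _ (meroField Ω ρ) g ≠ 0 :=
  (map_ne_zero_iff _ (IsFractionRing.injective _ _)).2 hg

theorem fracRadialNorm_div (hR : 0 < R) (hRρ : R < ρ) (f : analyticRing Ω ρ)
    {g : analyticRing Ω ρ} (hg : g ≠ 0) :
    fracRadialNorm R (algebraMap _ (meroField Ω ρ) f / algebraMap _ (meroField Ω ρ) g) =
      radialNorm R (f : Ω⟦X⟧) / radialNorm R (g : Ω⟦X⟧) :=
  fracRadialNorm_eq hR hRρ hg (div_mul_cancel₀ _ (algebraMap_ne_zero hg))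

theorem exists_eq_div (h : meroField Ω ρ) :
    ∃ f g : analyticRing Ω ρ, g ≠ 0 ∧
      h = algebraMap _ (meroField Ω ρ) f / algebraMap _ (meroField Ω ρ) g := by
  obtain ⟨f, g, hg, rfl⟩ := IsFractionRing.div_surjective (analyticRing Ω ρ) h
  exact ⟨f, g, nonZeroDivisors.ne_zero hg, rfl⟩

theorem fracRadialNorm_nonneg (h : meroField Ω ρ) : 0 ≤ fracRadialNorm R h :=
  div_nonneg (radialNorm_nonneg _) (radialNorm_nonneg _)

theorem fracRadialNorm_mul (hR : 0 < R) (hRρ : R < ρ) (x y : meroField Ω ρ) :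
    fracRadialNorm R (x * y) = fracRadialNorm R x * fracRadialNorm R y := by
  obtain ⟨f, g, hg, rfl⟩ := exists_eq_div x
  obtain ⟨f', g', hg', rfl⟩ := exists_eq_div y
  rw [div_mul_div_comm, ← map_mul, ← map_mul, fracRadialNorm_div hR hRρ _ (mul_ne_zero hg hg'),
    fracRadialNorm_div hR hRρ _ hg, fracRadialNorm_div hR hRρ _ hg', MulMemClass.coe_mul,
    MulMemClass.coe_mul, radialNorm_mul hR (f.2 R hR hRρ) (f'.2 R hR hRρ),
    radialNorm_mul hR (g.2 R hR hRρ) (g'.2 R hR hRρ), mul_div_mul_comm]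

theorem fracRadialNorm_eq_zero_iff (hR : 0 < R) (hRρ : R < ρ) (x : meroField Ω ρ) :
    fracRadialNorm R x = 0 ↔ x = 0 := by
  obtain ⟨f, g, hg, rfl⟩ := exists_eq_div x
  have hpos {a : analyticRing Ω ρ} (ha : a ≠ 0) : 0 < radialNorm R (a : Ω⟦X⟧) :=
    radialNorm_pos hR (a.2 R hR hRρ) (by simpa using ha)
  have hf : radialNorm R (f : Ω⟦X⟧) = 0 ↔ f = 0 :=
    ⟨fun h => of_not_not fun hf => (hpos hf).ne' h, by rintro rfl; exact radialNorm_zero R⟩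
  rw [fracRadialNorm_div hR hRρ _ hg, div_eq_zero_iff, or_iff_left (hpos hg).ne', hf,
    div_eq_zero_iff, or_iff_left (algebraMap_ne_zero hg),
    map_eq_zero_iff _ (IsFractionRing.injective _ _)]

theorem fracRadialNorm_add_le_max (hR : 0 < R) (hRρ : R < ρ) (x y : meroField Ω ρ) :
    fracRadialNorm R (x + y) ≤ max (fracRadialNorm R x) (fracRadialNorm R y) := by
  obtain ⟨f, g, hg, rfl⟩ := exists_eq_div x
  obtain ⟨f', g', hg', rfl⟩ := exists_eq_div y
  have hg0 := algebraMap_ne_zero hg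
  have hg0' := algebraMap_ne_zero hg'
  rw [← mul_div_mul_right _ _ hg0', ← mul_div_mul_left _ (algebraMap _ (meroField Ω ρ) g') hg0,
    ← add_div]
  simp only [← map_mul, ← map_add]
  simp only [fracRadialNorm_div hR hRρ _ (mul_ne_zero hg hg')]
  rw [max_div_div_right (radialNorm_nonneg _)]
  refine div_le_div_of_nonneg_right ?_ (radialNorm_nonneg _)
  exact gaussNorm_add_le_max _ _ _ _ hR.le norm_nonneg IsUltrametricDist.norm_add_le_max
    (hasGaussNorm_of_isRestricted ((f * g').2 R hR hRρ))
    (hasGaussNorm_of_isRestricted ((g * f').2 R hR hRρ))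

variable (Ω) in
/-- The Gauss norm `fracRadialNorm R` of radius `0 < R < ρ`, bundled as an absolute value. -/
def fracAbs (hR : 0 < R) (hRρ : R < ρ) : AbsoluteValue (meroField Ω ρ) ℝ where
  toFun := fracRadialNorm R
  map_mul' := fracRadialNorm_mul hR hRρ
  nonneg' := fracRadialNorm_nonneg
  eq_zero' := fracRadialNorm_eq_zero_iff hR hRρ
  add_le' x y := (fracRadialNorm_add_le_max hR hRρ x y).trans
    (max_le_add_of_nonneg (fracRadialNorm_nonneg x) (fracRadialNorm_nonneg y))

theorem fracAbs_apply (hR : 0 < R) (hRρ : R < ρ) (h : meroField Ω ρ) :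
    fracAbs Ω hR hRρ h = fracRadialNorm R h := rfl

variable (Ω) in
theorem isNonarchimedean_fracAbs (hR : 0 < R) (hRρ : R < ρ) :
    IsNonarchimedean (fracAbs Ω hR hRρ) :=
  fracRadialNorm_add_le_max hR hRρ

theorem fracAbs_algebraMap (hR : 0 < R) (hRρ : R < ρ) (f : analyticRing Ω ρ) :
    fracAbs Ω hR hRρ (algebraMap _ (meroField Ω ρ) f) = radialNorm R (f : Ω⟦X⟧) := by
  have h1 : radialNorm R (1 : Ω⟦X⟧) = 1 := by rw [← map_one C, radialNorm_C, norm_one]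
  simpa [fracAbs_apply, h1] using fracRadialNorm_div hR hRρ f one_ne_zero

variable (Ω) in
theorem fracAbs_natCast (hR : 0 < R) (hRρ : R < ρ) (m : ℕ) :
    fracAbs Ω hR hRρ (m : meroField Ω ρ) = ‖(m : Ω)‖ := by
  rw [← map_natCast (algebraMap (analyticRing Ω ρ) (meroField Ω ρ)), fracAbs_algebraMap,
    ← radialNorm_C (R := R), map_natCast, SubringClass.coe_natCast]

end GaussNorm

section CauchyEstimates
variable {Ω : Type*} [NormedField Ω] [IsUltrametricDist Ω] {ρ R : ℝ}

theorem iterate_D_algebraMap (s : ℕ) (f : analyticRing Ω ρ) :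
    (D Ω ρ)^[s] (algebraMap _ (meroField Ω ρ) f) =
      algebraMap _ (meroField Ω ρ) ((analyticDerivation Ω ρ)^[s] f) :=
  ((Function.Semiconj.iterate_right (fun f => (fractionDerivation_algebraMap _ f).symm) s).eq
    f).symm

theorem coe_iterate_analyticDerivation (s : ℕ) (f : analyticRing Ω ρ) :
    (((analyticDerivation Ω ρ)^[s] f : analyticRing Ω ρ) : Ω⟦X⟧) =
      (PowerSeries.derivative Ω)^[s] (f : Ω⟦X⟧) :=
  (Function.Semiconj.iterate_right (f := ((↑) : analyticRing Ω ρ → Ω⟦X⟧)) (fun _ => rfl) s).eq f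

variable [CharZero Ω]

instance : CharZero (meroField Ω ρ) :=
  charZero_of_injective_algebraMap (algebraMap Ω (meroField Ω ρ)).injective

theorem taylorBoundedAt_algebraMap (hR : 0 < R) (hRρ : R < ρ) (f : analyticRing Ω ρ) :
    TaylorBoundedAt (D Ω ρ) (fracAbs Ω hR hRρ) R (algebraMap _ (meroField Ω ρ) f) := by
  intro s
  have hs : 0 < ‖(s.factorial : Ω)‖ := by simpa using s.factorial_ne_zero
  rw [dividedIterate, map_mul, map_inv₀, fracAbs_natCast, iterate_D_algebraMap, fracAbs_algebraMap,
    fracAbs_algebraMap, coe_iterate_analyticDerivation, inv_mul_le_iff₀ hs]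
  exact radialNorm_iterate_derivative_le hR (f.2 R hR hRρ) s

theorem taylorBoundedAt_fracAbs (hR : 0 < R) (hRρ : R < ρ) (h : meroField Ω ρ) :
    TaylorBoundedAt (D Ω ρ) (fracAbs Ω hR hRρ) R h := by
  obtain ⟨f, g, hg, rfl⟩ := exists_eq_div h
  have hg0 := algebraMap_ne_zero hg
  refine .of_mul_right (isNonarchimedean_fracAbs Ω hR hRρ) hR hg0
    (taylorBoundedAt_algebraMap hR hRρ g) ?_
  rw [div_mul_cancel₀ _ hg0]
  exact taylorBoundedAt_algebraMap hR hRρ f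

theorem taylorReducible_fracAbs {p : ℕ} [Fact p.Prime] (hp : ‖(p : Ω)‖ = (p : ℝ)⁻¹) (hR : 0 < R)
    (hRρ : R < ρ) {n : ℕ} (u : Fin n → meroField Ω ρ) :
    TaylorReducible (D Ω ρ) (fracAbs Ω hR hRρ) R n (fun s => brace p s (n - 1)) u :=
  taylorReducible_brace (isNonarchimedean_fracAbs Ω hR hRρ)
    ((fracAbs_natCast Ω hR hRρ p).trans hp) hR (taylorBoundedAt_fracAbs hR hRρ) u

end CauchyEstimates

section Boundary
variable {Ω : Type*} [NormedField Ω] [IsUltrametricDist Ω] {ρ : ℝ} {h : meroField Ω ρ}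

theorem boundaryNorm_le_ofReal (hρ : 0 < ρ) {a : ℝ → ℝ} (ha : ContinuousAt a ρ)
    (hle : ∀ R, 0 < R → R < ρ → fracRadialNorm R h ≤ a R) :
    boundaryNorm h ≤ ENNReal.ofReal (a ρ) := by
  have hlim : Tendsto (fun R => ENNReal.ofReal (a R)) (𝓝[<] ρ) (𝓝 (ENNReal.ofReal (a ρ))) :=
    ENNReal.tendsto_ofReal (ha.tendsto.mono_left nhdsWithin_le_nhds)
  rw [← hlim.limsup_eq]
  refine limsup_le_limsup ?_
  filter_upwards [Ioo_mem_nhdsLT hρ] with R hR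
  exact ENNReal.ofReal_le_ofReal (hle R hR.1 hR.2)

theorem limsup_ofReal_mul_le {a : ℝ → ℝ} (ha : ContinuousAt a ρ) (ha0 : 0 < a ρ) (f : ℝ → ℝ≥0∞) :
    limsup (fun R => ENNReal.ofReal (a R) * f R) (𝓝[<] ρ) ≤
      ENNReal.ofReal (a ρ) * limsup f (𝓝[<] ρ) := by
  have hlim : limsup (fun R => ENNReal.ofReal (a R)) (𝓝[<] ρ) = ENNReal.ofReal (a ρ) :=
    (ENNReal.tendsto_ofReal (ha.tendsto.mono_left nhdsWithin_le_nhds)).limsup_eq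
  rw [← hlim]
  refine ENNReal.limsup_mul_le' (.inl ?_) (.inl ?_) <;> rw [hlim]
  exacts [(ENNReal.ofReal_pos.2 ha0).ne', ENNReal.ofReal_ne_top]

theorem boundaryNorm_le_iSup {ι : Type*} [Finite ι] (hρ : 0 < ρ) {a : ι → ℝ → ℝ}
    (ha : ∀ k, ContinuousAt (a k) ρ) (ha0 : ∀ k, 0 < a k ρ) {g : ι → meroField Ω ρ}
    (hle : ∀ R, 0 < R → R < ρ → ∃ k, fracRadialNorm R h ≤ a k R * fracRadialNorm R (g k)) :
    boundaryNorm h ≤ ⨆ k, ENNReal.ofReal (a k ρ) * boundaryNorm (g k) := by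
  cases nonempty_fintype ι
  calc boundaryNorm h
      ≤ limsup (fun R => Finset.univ.sup fun k =>
          ENNReal.ofReal (a k R) * ENNReal.ofReal (fracRadialNorm R (g k))) (𝓝[<] ρ) := by
        refine limsup_le_limsup ?_
        filter_upwards [Ioo_mem_nhdsLT hρ] with R hR
        obtain ⟨k, hk⟩ := hle R hR.1 hR.2
        refine le_trans ?_ (Finset.le_sup (Finset.mem_univ k))
        rw [← ENNReal.ofReal_mul' (fracRadialNorm_nonneg _)]
        exact ENNReal.ofReal_le_ofReal hk
    _ = Finset.univ.sup fun k => limsup (fun R =>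
          ENNReal.ofReal (a k R) * ENNReal.ofReal (fracRadialNorm R (g k))) (𝓝[<] ρ) :=
        limsup_finset_sup
    _ ≤ ⨆ k, ENNReal.ofReal (a k ρ) * boundaryNorm (g k) :=
        Finset.sup_le fun k _ => (limsup_ofReal_mul_le (ha k) (ha0 k) _).trans
          (le_iSup (fun k => ENNReal.ofReal (a k ρ) * boundaryNorm (g k)) k)

theorem boundaryNorm_le_matrixNorm {n : ℕ} (M : Matrix (Fin n) (Fin n) (meroField Ω ρ))
    (i j : Fin n) : boundaryNorm (M i j) ≤ matrixNorm M :=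
  le_iSup₂ (f := fun i j => boundaryNorm (M i j)) i j

end Boundary

section Systems
variable {p : ℕ} [Fact p.Prime] {Ω : Type*} [NormedField Ω] [IsUltrametricDist Ω] [CharZero Ω]
  {ρ : ℝ} {n : ℕ}

theorem continuousAt_inv_pow_mul_pow (hρ : 0 < ρ) (s j : ℕ) (b : ℝ) :
    ContinuousAt (fun R : ℝ => (R ^ s)⁻¹ * b * R ^ j) ρ := by
  have : ρ ^ s ≠ 0 := (pow_pos hρ s).ne'
  fun_prop (disch := assumption)

theorem ofReal_inv_pow_mul_mul_pow (hρ : 0 < ρ) (s j : ℕ) (b : ℝ≥0) :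
    ENNReal.ofReal ((ρ ^ s)⁻¹ * b * ρ ^ j) =
      ENNReal.ofReal ((ρ ^ s)⁻¹) * b * ENNReal.ofReal (ρ ^ j) := by
  rw [ENNReal.ofReal_mul (by positivity), ENNReal.ofReal_mul (by positivity),
    ENNReal.ofReal_coe_nnreal]

theorem existsUnique_vecMul_eq {m K : Type*} [Fintype m] [DecidableEq m] [Field K]
    {W : Matrix m m K} (hW : IsUnit W) (b : m → K) : ∃! G : m → K, b = Matrix.vecMul G W := by
  obtain ⟨G, hG⟩ := Matrix.vecMul_surjective_iff_isUnit.2 hW b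
  exact ⟨G, hG.symm, fun G' hG' => Matrix.vecMul_injective_of_isUnit hW (hG'.symm.trans hG.symm)⟩

theorem boundaryNorm_wronskian_coeff_le (hp : ‖(p : Ω)‖ = (p : ℝ)⁻¹) (hρ : 0 < ρ)
    {u : Fin n → meroField Ω ρ} (hu : IsUnit (wronskian u)) {s : ℕ} {G : Fin n → meroField Ω ρ}
    (hG : (fun j => dividedIterate (D Ω ρ) s (u j)) = Matrix.vecMul G (wronskian u)) (j : Fin n) :
    boundaryNorm (G j) ≤
      ENNReal.ofReal ((ρ ^ s)⁻¹) * (brace p s (n - 1) : ℝ≥0∞) * ENNReal.ofReal (ρ ^ (j : ℕ)) := by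
  rw [← ofReal_inv_pow_mul_mul_pow hρ]
  refine boundaryNorm_le_ofReal hρ (continuousAt_inv_pow_mul_pow hρ s j _) fun R hR hRρ => ?_
  obtain ⟨P, ⟨G', hPG', hG'⟩, hPu⟩ := taylorReducible_fracAbs hp hR hRρ u s
  have hGG' : G = G' := Matrix.vecMul_injective_of_isUnit hu <|
    hG.symm.trans (funext fun c => (hPu c).trans (hPG' (u c)))
  rw [hGG']
  exact hG' j

variable {A Y : Matrix (Fin n) (Fin n) (meroField Ω ρ)}

theorem iterMatrix_mul_apply (hY : Y.map (D Ω ρ) = A * Y) (s : ℕ) (i c : Fin n) :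
    (iterMatrix A s * Y) i c = dividedIterate (D Ω ρ) s (Y i c) :=
  (iterMatrix_spec (fun i => congrFun (congrFun hY i) c) s i).symm

theorem iterMatrix_apply_eq_sum (hYu : IsUnit Y) (hY : Y.map (D Ω ρ) = A * Y) {s : ℕ} {i : Fin n}
    {G : Fin n → meroField Ω ρ}
    (hG : ∀ c, dividedIterate (D Ω ρ) s (Y i c) = ∑ k, G k * (D Ω ρ)^[(k : ℕ)] (Y i c))
    (c : Fin n) :
    iterMatrix A s i c =
      ∑ k : Fin n, G k * ((((k : ℕ).factorial : ℕ) : meroField Ω ρ) • iterMatrix A k) i c := by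
  have hrow : Matrix.vecMul (iterMatrix A s i) Y = Matrix.vecMul (∑ k : Fin n,
      G k • ((((k : ℕ).factorial : ℕ) : meroField Ω ρ) • iterMatrix A k i)) Y := by
    funext c
    simp only [Matrix.sum_vecMul, Matrix.smul_vecMul, Finset.sum_apply, Pi.smul_apply, smul_eq_mul,
      ← Matrix.mul_apply_eq_vecMul, iterMatrix_mul_apply hY, factorial_mul_dividedIterate, hG]
  rw [Matrix.vecMul_injective_of_isUnit hYu hrow]
  simp only [Finset.sum_apply, Pi.smul_apply, smul_eq_mul, Matrix.smul_apply]

theorem exists_fracRadialNorm_iterMatrix_le (hp : ‖(p : Ω)‖ = (p : ℝ)⁻¹) (hYu : IsUnit Y)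
    (hY : Y.map (D Ω ρ) = A * Y) (s : ℕ) (i c : Fin n) {R : ℝ} (hR : 0 < R) (hRρ : R < ρ) :
    ∃ k : Fin n, fracRadialNorm R (iterMatrix A s i c) ≤
      (R ^ s)⁻¹ * brace p s (n - 1) * R ^ (k : ℕ) * fracRadialNorm R
        (((((k : ℕ).factorial : ℕ) : meroField Ω ρ) • iterMatrix A k) i c) := by
  obtain ⟨P, ⟨G, hPG, hG⟩, hPY⟩ := taylorReducible_fracAbs hp hR hRρ (Y i) s
  rw [iterMatrix_apply_eq_sum hYu hY (fun c => (hPY c).trans (hPG (Y i c))) c]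
  obtain ⟨k, -, hk⟩ := (isNonarchimedean_fracAbs Ω hR hRρ).finset_image_add_of_nonempty
    (fun k : Fin n => G k * ((((k : ℕ).factorial : ℕ) : meroField Ω ρ) • iterMatrix A k) i c)
    ⟨i, Finset.mem_univ i⟩
  refine ⟨k, hk.trans ?_⟩
  rw [map_mul]
  exact mul_le_mul_of_nonneg_right (hG k) (fracRadialNorm_nonneg _)

theorem matrixNorm_iterMatrix_le (hp : ‖(p : Ω)‖ = (p : ℝ)⁻¹) (hρ : 0 < ρ) (hYu : IsUnit Y)
    (hY : Y.map (D Ω ρ) = A * Y) (s : ℕ) :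
    matrixNorm (iterMatrix A s) ≤
      ENNReal.ofReal ((ρ ^ s)⁻¹) * (brace p s (n - 1) : ℝ≥0∞) *
        ⨆ i : Fin n, ENNReal.ofReal (ρ ^ (i : ℕ)) *
          matrixNorm ((((i : ℕ).factorial : ℕ) : meroField Ω ρ) • iterMatrix A i) := by
  have hbrace : (0 : ℝ) < brace p s (n - 1) :=
    NNReal.coe_pos.2 (zero_lt_one.trans_le (one_le_brace p s (n - 1)))
  refine iSup_le fun i => iSup_le fun c => ?_
  refine (boundaryNorm_le_iSup (Ω := Ω) hρ
    (a := fun (k : Fin n) R => (R ^ s)⁻¹ * brace p s (n - 1) * R ^ (k : ℕ))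
    (g := fun k : Fin n => ((((k : ℕ).factorial : ℕ) : meroField Ω ρ) • iterMatrix A k) i c)
    (fun k => continuousAt_inv_pow_mul_pow hρ s k _) (fun k => by positivity) fun R hR hRρ =>
      exists_fracRadialNorm_iterMatrix_le hp hYu hY s i c hR hRρ).trans ?_
  rw [ENNReal.mul_iSup]
  refine iSup_mono fun k => ?_
  rw [ofReal_inv_pow_mul_mul_pow hρ, mul_assoc _ _ (boundaryNorm _)]
  gcongr
  exact boundaryNorm_le_matrixNorm _ i c

end Systems

end
end DworkRobba

open DworkRobba in
theorem mainTheorem7_general (p : ℕ) [Fact p.Prime] (Ω : Type*) [NormedField Ω]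
    [IsUltrametricDist Ω] [CharZero Ω] (hp : ‖(p : Ω)‖ = (p : ℝ)⁻¹) (ρ : ℝ) (hρ : 0 < ρ) :
    (∀ (n : ℕ) (u : Fin n → meroField Ω ρ), IsUnit (wronskian u) → ∀ s : ℕ,
      (∃! G : Fin n → meroField Ω ρ,
        (fun j => dividedIterate (D Ω ρ) s (u j)) = Matrix.vecMul G (wronskian u)) ∧
      ∀ G : Fin n → meroField Ω ρ,
        (fun j => dividedIterate (D Ω ρ) s (u j)) = Matrix.vecMul G (wronskian u) →
        ∀ j, boundaryNorm (G j) ≤ ENNReal.ofReal ((ρ ^ s)⁻¹) * (brace p s (n - 1) : ℝ≥0∞) *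
          ENNReal.ofReal (ρ ^ (j : ℕ))) ∧
    ∀ (n : ℕ) (A Y : Matrix (Fin n) (Fin n) (meroField Ω ρ)), IsUnit Y →
      Y.map (D Ω ρ) = A * Y → ∀ s : ℕ,
        matrixNorm (iterMatrix A s) ≤
          ENNReal.ofReal ((ρ ^ s)⁻¹) * (brace p s (n - 1) : ℝ≥0∞) *
            ⨆ i : Fin n, ENNReal.ofReal (ρ ^ (i : ℕ)) *
              matrixNorm ((((i : ℕ).factorial : ℕ) : meroField Ω ρ) • iterMatrix A i) :=
  ⟨fun _ _ hu _ => ⟨existsUnique_vecMul_eq hu _,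
      fun _ hG => boundaryNorm_wronskian_coeff_le hp hρ hu hG⟩,
    fun _ _ _ hYu hY s => matrixNorm_iterMatrix_le hp hρ hYu hY s⟩

theorem mainTheorem7 (p : ℕ) [Fact p.Prime] (Ω : Type*) [NormedField Ω] [IsUltrametricDist Ω]
    [CharZero Ω] (hp : ‖(p : Ω)‖ = (p : ℝ)⁻¹) :
    -- Dwork–Robba, on the open unit disk
    (∀ (n : ℕ) (u : Fin n → DworkRobba.meroField Ω 1), IsUnit (DworkRobba.wronskian u) →
      ∀ s : ℕ,
        (∃! G : Fin n → DworkRobba.meroField Ω 1,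
          (fun j => ((s.factorial : ℕ) : DworkRobba.meroField Ω 1)⁻¹ *
            (DworkRobba.D Ω 1)^[s] (u j)) = Matrix.vecMul G (DworkRobba.wronskian u)) ∧
        ∀ G : Fin n → DworkRobba.meroField Ω 1,
          (fun j => ((s.factorial : ℕ) : DworkRobba.meroField Ω 1)⁻¹ *
            (DworkRobba.D Ω 1)^[s] (u j)) = Matrix.vecMul G (DworkRobba.wronskian u) →
          ∀ j, DworkRobba.boundaryNorm (G j) ≤ (DworkRobba.brace p s (n - 1) : ENNReal)) ∧
    -- differential systems on the open unit disk
    (∀ (n : ℕ) (A Y : Matrix (Fin n) (Fin n) (DworkRobba.meroField Ω 1)), IsUnit Y →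
      Y.map (DworkRobba.D Ω 1) = A * Y →
      ∀ s : ℕ,
        DworkRobba.matrixNorm (DworkRobba.iterMatrix A s) ≤
          (DworkRobba.brace p s (n - 1) : ENNReal) *
            ⨆ i : Fin n, DworkRobba.matrixNorm
              ((((i : ℕ).factorial : ℕ) : DworkRobba.meroField Ω 1) •
                DworkRobba.iterMatrix A i)) ∧
    -- differential systems on an open disk of radius `ρ`
    (∀ (ρ : ℝ), 0 < ρ →
      ∀ (n : ℕ) (A Y : Matrix (Fin n) (Fin n) (DworkRobba.meroField Ω ρ)), IsUnit Y →
      Y.map (DworkRobba.D Ω ρ) = A * Y →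
      ∀ s : ℕ,
        DworkRobba.matrixNorm (DworkRobba.iterMatrix A s) ≤
          ENNReal.ofReal ((ρ ^ s)⁻¹) * (DworkRobba.brace p s (n - 1) : ENNReal) *
            ⨆ i : Fin n, ENNReal.ofReal (ρ ^ (i : ℕ)) * DworkRobba.matrixNorm
              ((((i : ℕ).factorial : ℕ) : DworkRobba.meroField Ω ρ) •
                DworkRobba.iterMatrix A i)) := by
  obtain ⟨hWronskian, hSystem⟩ := mainTheorem7_general p Ω hp 1 one_pos
  refine ⟨fun n u hu s => ⟨(hWronskian n u hu s).1, fun G hG j => ?_⟩,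
    fun n A Y hYu hY s => ?_, fun ρ hρ => (mainTheorem7_general p Ω hp ρ hρ).2⟩
  · simpa using (hWronskian n u hu s).2 G hG j
  · simpa using hSystem n A Y hYu hY s
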